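/- Let $S$ be a monoid. All (left or right) $S$-acts are non-empty. For a right $S$-act $A$ and a left $S$-act $B$, $A\otimes B$ is the quotient of $A\times B$ by the equivalence relation generated by the pairs $((as,b),(a,sb))$ ($a\in A$, $b\in B$, $s\in S$). A *skeleton* over $S$ is a sequence $\mathcal S=(s_1,t_1,\dots,s_m,t_m)$ of elements of $S$ with $m\ge 1$. For $a,a'\in A$ and $b,b'\in B$, the pairs $(a,b)$ and $(a',b')$ are *connected by a tossing over $A$ and $B$ with skeleton $\mathcal S$* if there are $a_2,\dots,a_m\in A$ and $b_1,\dots,b_m\in B$ such that, with $a_1=a$ and $a_{m+1}=a'$, $$b=s_1b_1,\qquad t_ib_i=s_{i+1}b_{i+1}\ (1\le i<m),\qquad t_mb_m=b',\qquad a_is_i=a_{i+1}t_i\ (1\le i\le m).$$ Let $\mathcal C$ be a class of embeddings (injective $S$-morphisms) of right $S$-acts. A left $S$-act $B$ is *$\mathcal C$-flat* if for every $\mu:A\to A'$ in $\mathcal C$ the map $A\otimes B\to A'\otimes B$, $a\otimes b\mapsto a\mu\otimes b$, is one-one. Let $\mathcal{CF}$ be the class of $\mathcal C$-flat left $S$-acts,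 viewed as structures for the first order language with one unary function symbol for each $s\in S$; it is *axiomatisable* if it is the class of all models of some set of sentences of this language. **Theorem.** For every class $\mathcal C$ of embeddings of right $S$-acts the following are equivalent: (1) $\mathcal{CF}$ is axiomatisable; (2) $\mathcal{CF}$ is closed under ultraproducts; (3) for every skeleton $\mathcal S$ over $S$, every $\mu:A\to A'$ in $\mathcal C$ and all $a,a'\in A$ there is a finite set $F$ of skeletons such that, for every $\mathcal C$-flat left $S$-act $B$ and all $b,b'\in B$: if $(a\mu,b)$ and $(a'\mu,b')$ are connected by a tossing over $A'$ and $B$ with skeleton $\mathcal S$, then $(a,b)$ and $(a',b')$ are connected by a tossing over $A$ and $B$ with some skeleton in $F$. In particular, let $\mathcal{WF}$ be the class of weakly flat left $S$-acts, i.e. $\mathcal{WF}=\mathcal{CF}$ where $\mathcal C$ is the class of all inclusions of right ideals of $S$ into $S$. Then the following are equivalent: (i) $\mathcal{WF}$ is axiomatisable; (ii) $\mathcal{WF}$ is closed under ultraproducts; (iii) for every skeleton $\mathcal S$ over $S$ and all $a,a'\in S$ there is a finite set $F$ of skeletons such that, for every weakly flat left $S$-act $B$ and all $b,b'\in B$: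 if $(a,b)$ and $(a',b')$ are connected by a tossing over $S$ and $B$ with skeleton $\mathcal S$, then $(a,b)$ and $(a',b')$ are connected by a tossing over $aS\cup a'S$ and $B$ with some skeleton in $F$. -/

import Mathlib

universe u v w

open scoped RightActions

namespace SAct

/-! Left `S`-acts are types with `MulAction S B`, right `S`-acts are types with
`MulAction Sᵐᵒᵖ A`; the right action of `s` on `a` is written `a <• s`.  Acts are non-empty. -/

section Tensor

variable (S : Type u) [Monoid S] (A : Type v) [MulAction Sᵐᵒᵖ A] (B : Type w) [MulAction S B]

/-- The generating relation `{((as, b), (a, sb))}` of the tensor product. -/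
inductive TensorRel : A × B → A × B → Prop
  | balance (a : A) (s : S) (b : B) : TensorRel (a <• s, b) (a, s • b)

/-- The tensor product `A ⊗ B`: the quotient of `A × B` by the equivalence relation generated by
the pairs `((as, b), (a, sb))`. -/
def Tensor : Type (max v w) :=
  Quotient (Relation.EqvGen.setoid (TensorRel S A B))

variable {S A B}

/-- The element `a ⊗ b`. -/
def tmul (a : A) (b : B) : Tensor S A B :=
  Quotient.mk (Relation.EqvGen.setoid (TensorRel S A B)) (a, b)

end Tensor

/-- The map `f ⊗ I_B : A ⊗ B → A' ⊗ B`, `a ⊗ b ↦ f a ⊗ b`, induced by a morphism `f : A → A'` of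
right `S`-acts. -/
def tensorMap {S : Type u} [Monoid S] {A A' : Type v} [MulAction Sᵐᵒᵖ A] [MulAction Sᵐᵒᵖ A']
    (f : A →[Sᵐᵒᵖ] A') (B : Type w) [MulAction S B] : Tensor S A B → Tensor S A' B :=
  Quotient.lift (fun p => tmul (f p.1) p.2) (by
    intro p q h
    change Relation.EqvGen (TensorRel S A B) p q at h
    induction h with
    | rel p q h =>
      obtain ⟨a, s, b⟩ := h
      apply Quotient.sound
      apply Relation.EqvGen.rel
      rw [map_smul]
      exact TensorRel.balance (f a) s b
    | refl p => rfl
    | symm p q _ ih => exact ih.symm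
    | trans p q r _ _ ih₁ ih₂ => exact ih₁.trans ih₂)

/-- An embedding (injective `S`-morphism) of right `S`-acts. -/
structure RightEmbedding (S : Type u) [Monoid S] : Type (u + 1) where
  /-- the domain -/
  dom : Type u
  /-- the codomain -/
  cod : Type u
  [nonemptyDom : Nonempty dom]
  [nonemptyCod : Nonempty cod]
  [actDom : MulAction Sᵐᵒᵖ dom]
  [actCod : MulAction Sᵐᵒᵖ cod]
  /-- the morphism -/
  hom : dom →[Sᵐᵒᵖ] cod
  injective : Function.Injective hom

attribute [instance] RightEmbedding.nonemptyDom RightEmbedding.nonemptyCod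
  RightEmbedding.actDom RightEmbedding.actCod

/-- A left `S`-act `B` is `C`-flat if `μ ⊗ I_B` is one-one for every `μ` in `C`. -/
def CFlat {S : Type u} [Monoid S] (C : Set (RightEmbedding S)) (B : Type u) [MulAction S B] :
    Prop :=
  ∀ μ ∈ C, Function.Injective (tensorMap μ.hom B)

/-- A skeleton `(s₁, t₁, …, sₘ, tₘ)`, of length `m = n + 1 ≥ 1`; here `s i`, `t i` are indexed
from `0`. -/
structure Skeleton (S : Type u) where
  /-- the length minus one -/
  n : ℕ
  /-- the entries `s₁, …, sₘ` -/
  s : Fin (n + 1) → S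
  /-- the entries `t₁, …, tₘ` -/
  t : Fin (n + 1) → S

/-- A tossing over `A` and `B` with skeleton `𝒮` connecting `(a, b)` to `(a', b')`.
With `m = n + 1`, the elements `x 0, …, x m` are `a, a₂, …, aₘ, a'`, and `y 0, …, y (m - 1)` are
`b₁, …, bₘ`. -/
structure Tossing {S : Type u} [Monoid S] (𝒮 : Skeleton S) {A : Type v} [MulAction Sᵐᵒᵖ A]
    {B : Type w} [MulAction S B] (a : A) (b : B) (a' : A) (b' : B) where
  /-- the elements `a, a₂, …, aₘ, a'` -/
  x : Fin (𝒮.n + 2) → A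
  /-- the elements `b₁, …, bₘ` -/
  y : Fin (𝒮.n + 1) → B
  x_first : x 0 = a
  x_last : x (Fin.last _) = a'
  x_step : ∀ i : Fin (𝒮.n + 1), x i.castSucc <• 𝒮.s i = x i.succ <• 𝒮.t i
  y_first : b = 𝒮.s 0 • y 0
  y_step : ∀ i : Fin 𝒮.n, 𝒮.t i.castSucc • y i.castSucc = 𝒮.s i.succ • y i.succ
  y_last : 𝒮.t (Fin.last _) • y (Fin.last _) = b'

/-- `(a, b)` and `(a', b')` are connected by a tossing over `A` and `B` with skeleton `𝒮`. -/
def Connected {S : Type u} [Monoid S] (𝒮 : Skeleton S) {A : Type v} [MulAction Sᵐᵒᵖ A]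
    {B : Type w} [MulAction S B] (a : A) (b : B) (a' : A) (b' : B) : Prop :=
  Nonempty (Tossing 𝒮 a b a' b')

/-- The function symbols of the language of left `S`-acts: one unary symbol `λ_s` for each
`s ∈ S`. -/
inductive ActFunctions (S : Type u) : ℕ → Type u
  | lam (s : S) : ActFunctions S 1

/-- The first order language `L_S` of left `S`-acts: the unary symbols `λ_s`, no constants and no
relation symbols (other than equality). -/
def actLanguage (S : Type u) : FirstOrder.Language.{u, 0} :=
  ⟨ActFunctions S, fun _ => Empty⟩

/-- A left `S`-act as an `L_S`-structure: `λ_s` is interpreted as `x ↦ s x`. -/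
@[reducible]
def actStructure (S : Type u) [Monoid S] (B : Type u) [MulAction S B] :
    (actLanguage S).Structure B where
  funMap := fun f x => match f, x with
    | ActFunctions.lam s, x => s • x 0
  RelMap := fun r => r.elim

/-- The class `𝓒𝓕` of `C`-flat left `S`-acts, as a class of `L_S`-structures: the structure is
that of a left `S`-act, and this act is `C`-flat. -/
def CF {S : Type u} [Monoid S] (C : Set (RightEmbedding S)) (M : Type u)
    (str : (actLanguage S).Structure M) : Prop :=
  ∃ act : MulAction S M, actStructure S M = str ∧ CFlat C M

/-- A class `K` of (non-empty) `L`-structures is axiomatisable if there is a set `T` of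
`L`-sentences such that an `L`-structure is in `K` if and only if it satisfies `T`. -/
def Axiomatisable {L : FirstOrder.Language.{u, 0}}
    (K : (M : Type u) → L.Structure M → Prop) : Prop :=
  ∃ T : L.Theory, ∀ (M : Type u) [Nonempty M] [str : L.Structure M], K M str ↔ M ⊨ T

/-- A class `K` of (non-empty) `L`-structures is closed under ultraproducts. -/
def ClosedUnderUltraproducts {L : FirstOrder.Language.{u, 0}}
    (K : (M : Type u) → L.Structure M → Prop) : Prop :=
  ∀ (I : Type u) (U : Ultrafilter I) (M : I → Type u) [∀ i, Nonempty (M i)]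
    [str : ∀ i, L.Structure (M i)],
    (∀ i, K (M i) (str i)) →
      K ((U : Filter I).Product M) FirstOrder.Language.Ultraproduct.structure

section WeaklyFlat

variable (S : Type u) [Monoid S]

/-- The inclusion of a (non-empty) right ideal `K` of `S` into `S`. -/
def idealInclusion (K : SubMulAction Sᵐᵒᵖ S) (hK : (K : Set S).Nonempty) : RightEmbedding S :=
  haveI : Nonempty K := hK.to_subtype
  { dom := K
    cod := S
    hom := K.subtype
    injective := Subtype.val_injective }

/-- The class of all embeddings of right ideals of `S` into `S`; a left `S`-act is weakly flat if
it is flat with respect to this class. -/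
def rightIdealEmbeddings : Set (RightEmbedding S) :=
  {μ | ∃ (K : SubMulAction Sᵐᵒᵖ S) (hK : (K : Set S).Nonempty), μ = idealInclusion S K hK}

variable {S}

/-- The right ideal `aS ∪ a'S` of `S`. -/
def pairIdeal (a a' : S) : SubMulAction Sᵐᵒᵖ S where
  carrier := {x | ∃ r : S, x = a * r ∨ x = a' * r}
  smul_mem' := by
    rintro c x ⟨r, rfl | rfl⟩
    · exact ⟨r * c.unop, Or.inl (mul_assoc _ _ _)⟩
    · exact ⟨r * c.unop, Or.inr (mul_assoc _ _ _)⟩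

/-- `a` as an element of `aS ∪ a'S`. -/
def pairIdeal.left (a a' : S) : pairIdeal a a' := ⟨a, 1, Or.inl (mul_one a).symm⟩

/-- `a'` as an element of `aS ∪ a'S`. -/
def pairIdeal.right (a a' : S) : pairIdeal a a' := ⟨a', 1, Or.inr (mul_one a').symm⟩

end WeaklyFlat

end SAct

/-! A tossing splits into two independent halves: equations among elements of the right act, and a
system in the left act. For a fixed skeleton the second half is a first-order (positive primitive)
condition on `(b, b')`, and the first does not involve the left act at all (`connected_iff`). Since
equality in the tensor product means being connected by some tossing (`tmul_eq_iff`), flatness says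
that a tossing over the codomain forces one of possibly infinitely many tossings over the domain. It
becomes first-order once finitely many skeletons suffice. Łoś's theorem gives (1) ⇒ (2) and, by a
compactness argument, (2) ⇒ (3); for (3) ⇒ (1) the finite disjunctions are written as sentences. -/

namespace SAct

/-! ### The two halves of a tossing -/

section Linked

variable {S : Type u} [Monoid S]

/-- The part of a tossing with skeleton `𝒮` that lives in the right act. -/
def RightLinked (𝒮 : Skeleton S) {A : Type v} [MulAction Sᵐᵒᵖ A] (a a' : A) : Prop :=
  ∃ x : Fin (𝒮.n + 2) → A, x 0 = a ∧ x (Fin.last _) = a' ∧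
    ∀ i : Fin (𝒮.n + 1), x i.castSucc <• 𝒮.s i = x i.succ <• 𝒮.t i

/-- The part of a tossing with skeleton `𝒮` that lives in the left act. -/
def LeftLinked (𝒮 : Skeleton S) {B : Type w} [MulAction S B] (b b' : B) : Prop :=
  ∃ y : Fin (𝒮.n + 1) → B, b = 𝒮.s 0 • y 0 ∧
    (∀ i : Fin 𝒮.n, 𝒮.t i.castSucc • y i.castSucc = 𝒮.s i.succ • y i.succ) ∧
    𝒮.t (Fin.last _) • y (Fin.last _) = b'

theorem connected_iff {𝒮 : Skeleton S} {A : Type v} [MulAction Sᵐᵒᵖ A] {B : Type w}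
    [MulAction S B] {a a' : A} {b b' : B} :
    Connected 𝒮 a b a' b' ↔ RightLinked 𝒮 a a' ∧ LeftLinked 𝒮 b b' :=
  ⟨fun ⟨T⟩ => ⟨⟨T.x, T.x_first, T.x_last, T.x_step⟩, ⟨T.y, T.y_first, T.y_step, T.y_last⟩⟩,
    fun ⟨⟨x, h₁, h₂, h₃⟩, ⟨y, h₄, h₅, h₆⟩⟩ => ⟨⟨x, y, h₁, h₂, h₃, h₄, h₅, h₆⟩⟩⟩

theorem RightLinked.map {𝒮 : Skeleton S} {A A' : Type v} [MulAction Sᵐᵒᵖ A] [MulAction Sᵐᵒᵖ A']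
    (f : A →[Sᵐᵒᵖ] A') {a a' : A} (h : RightLinked 𝒮 a a') : RightLinked 𝒮 (f a) (f a') := by
  obtain ⟨x, rfl, rfl, h⟩ := h
  exact ⟨fun i => f (x i), rfl, rfl, fun i => by rw [← map_smul, ← map_smul, h i]⟩

end Linked

/-! ### Equality in the tensor product -/

section TensorEq

variable {S : Type u} [Monoid S] {A : Type v} [MulAction Sᵐᵒᵖ A] {B : Type w} [MulAction S B]

theorem tmul_smul (a : A) (s : S) (b : B) :
    (tmul (a <• s) b : Tensor S A B) = tmul a (s • b) :=
  Quotient.sound (Relation.EqvGen.rel _ _ (TensorRel.balance a s b))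

theorem Connected.tmul_eq {𝒮 : Skeleton S} {a a' : A} {b b' : B}
    (h : Connected 𝒮 a b a' b') : (tmul a b : Tensor S A B) = tmul a' b' := by
  obtain ⟨T⟩ := h
  have step : ∀ i : Fin (𝒮.n + 1),
      (tmul (T.x i.castSucc) (𝒮.s i • T.y i) : Tensor S A B) = tmul (T.x i.succ) (𝒮.t i • T.y i) := fun i => by
    rw [← tmul_smul, ← tmul_smul, T.x_step]
  have reach : ∀ i : Fin (𝒮.n + 1),
      (tmul a b : Tensor S A B) = tmul (T.x i.castSucc) (𝒮.s i • T.y i) := by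
    intro i
    induction i using Fin.induction with
    | zero => rw [Fin.castSucc_zero, T.x_first, ← T.y_first]
    | succ i ih => rw [ih, step, T.y_step, Fin.succ_castSucc]
  rw [reach (Fin.last _), step, T.y_last, Fin.succ_last, T.x_last]

/-- The skeleton of length one. -/
def Skeleton.single (s t : S) : Skeleton S := ⟨0, fun _ => s, fun _ => t⟩

/-- The skeleton `(s, t, s₁, t₁, …, sₘ, tₘ)`. -/
def Skeleton.cons (s t : S) (𝒮 : Skeleton S) : Skeleton S :=
  ⟨𝒮.n + 1, Fin.cons s 𝒮.s, Fin.cons t 𝒮.t⟩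

theorem connected_single {a a' : A} {s t : S} (h : a <• s = a' <• t) (y : B) :
    Connected (Skeleton.single s t) a (s • y) a' (t • y) :=
  ⟨{ x := ![a, a']
     y := fun _ => y
     x_first := rfl
     x_last := rfl
     x_step := fun i => by
      obtain rfl : i = 0 := Subsingleton.elim (α := Fin 1) _ _
      exact h
     y_first := rfl
     y_step := fun i => i.elim0
     y_last := rfl }⟩

theorem Connected.cons {𝒮 : Skeleton S} {a a₁ a' : A} {b' : B} {s t : S} (h : a <• s = a₁ <• t)
    {y : B} (hc : Connected 𝒮 a₁ (t • y) a' b') :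
    Connected (𝒮.cons s t) a (s • y) a' b' := by
  obtain ⟨T⟩ := hc
  refine ⟨{ x := (Fin.cons a T.x : Fin (𝒮.n + 1 + 1 + 1) → A)
            y := (Fin.cons y T.y : Fin (𝒮.n + 1 + 1) → B)
            x_first := rfl
            x_last := T.x_last
            x_step := fun i => ?_
            y_first := rfl
            y_step := fun i => ?_
            y_last := T.y_last }⟩
  · refine Fin.cases ?_ (fun j => ?_) i
    · change a <• s = T.x 0 <• t
      rw [T.x_first, h]
    · exact T.x_step j
  · change Fin (𝒮.n + 1) at i
    refine Fin.cases ?_ (fun j => ?_) i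
    · exact T.y_first
    · exact T.y_step j

/-- Each generating pair, used in either direction, is one tossing step with an entry equal to `1`,
so a chain of them is assembled by `Connected.cons`. -/
theorem exists_connected_of_eqvGen {p q : A × B} (h : Relation.EqvGen (TensorRel S A B) p q) :
    ∃ 𝒮 : Skeleton S, Connected 𝒮 p.1 p.2 q.1 q.2 := by
  rw [← Relation.EqvGen.reflTransGen_symmGen] at h
  induction h using Relation.ReflTransGen.head_induction_on with
  | refl =>
    -- Skeletons have length at least one, so the empty chain needs the skeleton `(1, 1)`.
    have := connected_single (rfl : q.1 <• (1 : S) = q.1 <• (1 : S)) q.2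
    rw [one_smul] at this
    exact ⟨_, this⟩
  | head h _ ih =>
    obtain ⟨𝒮, ih⟩ := ih
    rcases h with ⟨a, s, b⟩ | ⟨a, s, b⟩
    · have := Connected.cons (a := a <• s) (s := 1) (by simp) ih
      rw [one_smul] at this
      exact ⟨_, this⟩
    · rw [← one_smul S b] at ih
      have := Connected.cons (a := a) (s := s) (by simp) ih
      exact ⟨_, by simpa using this⟩

theorem tmul_eq_iff {a a' : A} {b b' : B} :
    (tmul a b : Tensor S A B) = tmul a' b' ↔ ∃ 𝒮 : Skeleton S, Connected 𝒮 a b a' b' :=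
  ⟨fun h => exists_connected_of_eqvGen (Quotient.exact h), fun ⟨_, h⟩ => h.tmul_eq⟩

end TensorEq

theorem cFlat_iff {S : Type u} [Monoid S] {C : Set (RightEmbedding S)} {B : Type u}
    [MulAction S B] : CFlat C B ↔ ∀ μ ∈ C, ∀ (a a' : μ.dom) (b b' : B),
      (∃ 𝒮 : Skeleton S, Connected 𝒮 (μ.hom a) b (μ.hom a') b') →
        ∃ 𝒮 : Skeleton S, Connected 𝒮 a b a' b' := by
  refine forall₂_congr fun μ _ => ?_
  simp only [← tmul_eq_iff]
  constructor
  · intro h a a' b b' he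
    exact h he
  · rintro h ⟨a, b⟩ ⟨a', b'⟩ he
    exact h a a' b b' he

/-! ### Axiomatisability and ultraproducts -/

section FirstOrder

open FirstOrder Language

variable {S : Type u} [Monoid S]

/-- The term `λ_s τ`. -/
def lamTerm (s : S) {α : Type*} (τ : (actLanguage S).Term α) : (actLanguage S).Term α :=
  Term.func (ActFunctions.lam s : (actLanguage S).Functions 1) fun _ => τ

/-- The formula, in the variables `0` and `1`, expressing `LeftLinked 𝒮`. -/
noncomputable def linkFormula (𝒮 : Skeleton S) : (actLanguage S).Formula (Fin 2) :=
  let y : Fin (𝒮.n + 1) → (actLanguage S).Term (Fin 2 ⊕ Fin (𝒮.n + 1)) := fun i => Term.var (.inr i)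
  Formula.iExs (Fin (𝒮.n + 1))
    ((Term.var (.inl 0)).equal (lamTerm (𝒮.s 0) (y 0)) ⊓
      (Formula.iInf (fun i : Fin 𝒮.n =>
        (lamTerm (𝒮.t i.castSucc) (y i.castSucc)).equal (lamTerm (𝒮.s i.succ) (y i.succ))) ⊓
      (lamTerm (𝒮.t (Fin.last _)) (y (Fin.last _))).equal (Term.var (.inl 1))))

theorem realize_lamTerm {M : Type u} [MulAction S M] {α : Type*} (s : S)
    (τ : (actLanguage S).Term α) (v : α → M) :
    letI := actStructure S M
    (lamTerm s τ).realize v = s • τ.realize v :=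
  rfl

theorem realize_linkFormula {M : Type u} [act : MulAction S M] [str : (actLanguage S).Structure M]
    (h : actStructure S M = str) (𝒮 : Skeleton S) (v : Fin 2 → M) :
    (linkFormula 𝒮).Realize v ↔ LeftLinked 𝒮 (v 0) (v 1) := by
  subst h
  simp [linkFormula, LeftLinked, Formula.realize_iExs, realize_lamTerm, Formula.realize_iInf]

/-- The sentence stating that `LeftLinked 𝒮 b b'` implies `LeftLinked 𝒮' b b'` for some `𝒮' ∈ F`,
for all `b` and `b'`. -/
noncomputable def linkSentence (𝒮 : Skeleton S) (F : Finset (Skeleton S)) :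
    (actLanguage S).Sentence :=
  Formula.iAlls (Fin 2)
    (((linkFormula 𝒮).imp (Formula.iSup fun 𝒮' : F => linkFormula 𝒮'.1)).relabel Sum.inr)

theorem realize_linkSentence {M : Type u} [act : MulAction S M]
    [str : (actLanguage S).Structure M] (h : actStructure S M = str) (𝒮 : Skeleton S)
    (F : Finset (Skeleton S)) :
    M ⊨ linkSentence 𝒮 F ↔
      ∀ b b' : M, LeftLinked 𝒮 b b' → ∃ 𝒮' ∈ F, LeftLinked 𝒮' b b' := by
  have key : M ⊨ linkSentence 𝒮 F ↔
      ∀ v : Fin 2 → M, LeftLinked 𝒮 (v 0) (v 1) → ∃ 𝒮' ∈ F, LeftLinked 𝒮' (v 0) (v 1) := by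
    simp [linkSentence, Sentence.Realize, Formula.realize_iAlls, Formula.realize_relabel,
      Formula.realize_imp, Formula.realize_iSup, Function.comp_def, realize_linkFormula h]
  rw [key]
  exact ⟨fun H b b' => H ![b, b'], fun H v => H _ _⟩

/-- The sentence `∀ x, λ_1 x = x`. -/
noncomputable def oneSentence (S : Type u) [Monoid S] : (actLanguage S).Sentence :=
  Formula.iAlls (Fin 1)
    ((lamTerm 1 (Term.var (.inr 0))).equal (Term.var (.inr 0)))

/-- The sentence `∀ x, λ_{st} x = λ_s λ_t x`. -/
noncomputable def mulSentence (s t : S) : (actLanguage S).Sentence :=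
  Formula.iAlls (Fin 1)
    ((lamTerm (s * t) (Term.var (.inr 0))).equal (lamTerm s (lamTerm t (Term.var (.inr 0)))))

/-- The interpretation of `λ_s`. -/
def lamMap {M : Type u} [str : (actLanguage S).Structure M] (s : S) (x : M) : M :=
  str.funMap (ActFunctions.lam s) fun _ => x

theorem realize_lamTerm_eq_lamMap {S M : Type u} [str : (actLanguage S).Structure M] {α : Type*} (s : S)
    (τ : (actLanguage S).Term α) (v : α → M) :
    (lamTerm s τ).realize v = lamMap s (τ.realize v) :=
  rfl

theorem realize_oneSentence {M : Type u} [str : (actLanguage S).Structure M] :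
    M ⊨ oneSentence S ↔ ∀ x : M, lamMap (1 : S) x = x := by
  have : M ⊨ oneSentence S ↔ ∀ v : Fin 1 → M, lamMap (1 : S) (v 0) = v 0 := by
    simp [oneSentence, Sentence.Realize, Formula.realize_iAlls, realize_lamTerm_eq_lamMap]
  rw [this]
  exact ⟨fun H x => H fun _ => x, fun H v => H _⟩

theorem realize_mulSentence {M : Type u} [str : (actLanguage S).Structure M] {s t : S} :
    M ⊨ mulSentence s t ↔ ∀ x : M, lamMap (s * t) x = lamMap s (lamMap t x) := by
  have : M ⊨ mulSentence s t ↔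
      ∀ v : Fin 1 → M, lamMap (s * t) (v 0) = lamMap s (lamMap t (v 0)) := by
    simp [mulSentence, Sentence.Realize, Formula.realize_iAlls, realize_lamTerm_eq_lamMap]
  rw [this]
  exact ⟨fun H x => H fun _ => x, fun H v => H _⟩

theorem exists_actStructure_eq {M : Type u} [str : (actLanguage S).Structure M]
    (h₁ : M ⊨ oneSentence S) (h₂ : ∀ s t : S, M ⊨ mulSentence s t) :
    ∃ _ : MulAction S M, actStructure S M = str := by
  refine ⟨{ smul := lamMap
            one_smul := realize_oneSentence.1 h₁
            mul_smul := fun s t => realize_mulSentence.1 (h₂ s t) }, ?_⟩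
  ext n f x
  · obtain ⟨s⟩ := f
    change str.funMap (ActFunctions.lam s) (fun _ => x 0) = str.funMap (ActFunctions.lam s) x
    congr 1
    ext i
    rw [Subsingleton.elim i 0]
  · exact f.elim

theorem Axiomatisable.closedUnderUltraproducts {L : FirstOrder.Language.{u, 0}}
    {K : (M : Type u) → L.Structure M → Prop} (h : Axiomatisable K) :
    ClosedUnderUltraproducts K := by
  obtain ⟨T, hT⟩ := h
  intro I U M _ str hM
  refine (hT _).2 ⟨fun φ hφ => ?_⟩
  rw [Ultraproduct.sentence_realize]
  exact .of_forall fun i => ((hT (M i)).1 (hM i)).realize_of_mem φ hφ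

/-- Every tossing with skeleton `𝒮` over the codomain of `μ ∈ C` can be replaced, in `C`-flat acts,
by a tossing over the domain with one of finitely many skeletons. -/
def FinitelyReplaceable (C : Set (RightEmbedding S)) : Prop :=
  ∀ (𝒮 : Skeleton S) (μ : RightEmbedding S), μ ∈ C → ∀ a a' : μ.dom,
    ∃ F : Finset (Skeleton S),
      ∀ (B : Type u) [Nonempty B] [MulAction S B], CFlat C B → ∀ b b' : B,
        Connected 𝒮 (μ.hom a) b (μ.hom a') b' → ∃ 𝒮' ∈ F, Connected 𝒮' a b a' b'

/-- If every finite `F` fails for some flat act `B F`, the ultraproduct of these acts is flat, so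
one skeleton `𝒯` works there, hence in `B F` for some `F` containing `𝒯`. -/
theorem ClosedUnderUltraproducts.finitelyReplaceable {C : Set (RightEmbedding S)}
    (h : ClosedUnderUltraproducts (CF C)) : FinitelyReplaceable C := by
  intro 𝒮 μ hμ a a'
  by_contra! hcon
  choose B hne act hflat b b' hconn hnot using hcon
  let str := fun F => @actStructure S _ (B F) (act F)
  -- Refining `atTop` ensures that every given skeleton lies in `U`-almost every `F`.
  let U : Ultrafilter (Finset (Skeleton S)) := Ultrafilter.of Filter.atTop
  obtain ⟨actU, hstr, hU⟩ := h _ U B fun F => ⟨act F, rfl, hflat F⟩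
  let q : (∀ F, B F) → (U : Filter (Finset (Skeleton S))).Product B := fun c => c
  have los : ∀ 𝒯 : Skeleton S,
      LeftLinked 𝒯 (q b) (q b') ↔
        ∀ᶠ F in (U : Filter (Finset (Skeleton S))), LeftLinked 𝒯 (b F) (b' F) := by
    intro 𝒯
    have := Ultraproduct.realize_formula_cast (u := U) (linkFormula 𝒯) ![b, b']
    exact (realize_linkFormula hstr 𝒯 fun i => q (![b, b'] i)).symm.trans
      (this.trans (Filter.eventually_congr (.of_forall fun F => realize_linkFormula rfl 𝒯 _)))
  -- The right half is the same for all `F`, so it may be read off at `F = ∅`.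
  obtain ⟨𝒯, h𝒯⟩ := cFlat_iff.1 hU μ hμ a a' (q b) (q b') ⟨𝒮, connected_iff.2
    ⟨(connected_iff.1 (hconn ∅)).1, (los 𝒮).2 (.of_forall fun F => (connected_iff.1 (hconn F)).2)⟩⟩
  obtain ⟨hr, hl⟩ := connected_iff.1 h𝒯
  have hmem : ∀ᶠ F in (U : Filter (Finset (Skeleton S))), {𝒯} ⊆ F :=
    (Ultrafilter.of_le Filter.atTop) (Filter.eventually_ge_atTop (α := Finset (Skeleton S)) {𝒯})
  obtain ⟨F, hF, hF'⟩ := (((los 𝒯).1 hl).and hmem).exists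
  exact hnot F 𝒯 (Finset.singleton_subset_iff.1 hF') (connected_iff.2 ⟨hr, hF⟩)

theorem FinitelyReplaceable.axiomatisable {C : Set (RightEmbedding S)}
    (h : FinitelyReplaceable C) : Axiomatisable (CF C) := by
  classical
  -- The axioms are all sentences true throughout the class.
  refine ⟨{φ | ∀ (M : Type u) [Nonempty M] [str : (actLanguage S).Structure M],
    CF C M str → M ⊨ φ}, fun M _ str => ⟨fun hM => ⟨fun φ hφ => hφ M hM⟩, fun hM => ?_⟩⟩
  obtain ⟨act, hact⟩ : ∃ act : MulAction S M, actStructure S M = str := by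
    refine exists_actStructure_eq (hM.realize_of_mem _ ?_) fun s t => hM.realize_of_mem _ ?_
    · rintro N _ str ⟨act, hstr, -⟩
      subst hstr
      exact (realize_oneSentence (str := actStructure S N)).2 (one_smul S)
    · rintro N _ str ⟨act, hstr, -⟩
      subst hstr
      exact (realize_mulSentence (str := actStructure S N)).2 (mul_smul s t)
  refine ⟨act, hact, cFlat_iff.2 ?_⟩
  rintro μ hμ a a' b b' ⟨𝒮, h𝒮⟩
  obtain ⟨F, hF⟩ := h 𝒮 μ hμ a a'
  obtain ⟨hr, hl⟩ := connected_iff.1 h𝒮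
  -- The sentence sees only left halves, so `F` is first cut down to the skeletons whose right half
  -- is solvable between `a` and `a'`.
  have hs : M ⊨ linkSentence 𝒮 (F.filter fun 𝒯 => RightLinked 𝒯 a a') := by
    refine hM.realize_of_mem _ ?_
    rintro N _ str ⟨act, hstr, hN⟩
    refine (realize_linkSentence hstr _ _).2 fun c c' hc => ?_
    obtain ⟨𝒯, h𝒯, hc𝒯⟩ := hF N hN c c' (connected_iff.2 ⟨hr, hc⟩)
    rw [connected_iff] at hc𝒯
    exact ⟨𝒯, Finset.mem_filter.2 ⟨h𝒯, hc𝒯.1⟩, hc𝒯.2⟩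
  obtain ⟨𝒯, h𝒯, hb⟩ := (realize_linkSentence hact _ _).1 hs b b' hl
  exact ⟨𝒯, connected_iff.2 ⟨(Finset.mem_filter.1 h𝒯).2, hb⟩⟩

theorem tfae_axiomatisable_CF (C : Set (RightEmbedding S)) :
    List.TFAE [Axiomatisable (CF C), ClosedUnderUltraproducts (CF C), FinitelyReplaceable C] := by
  tfae_have 1 → 2 := Axiomatisable.closedUnderUltraproducts
  tfae_have 2 → 3 := ClosedUnderUltraproducts.finitelyReplaceable
  tfae_have 3 → 1 := FinitelyReplaceable.axiomatisable
  tfae_finish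

end FirstOrder

/-! ### Weak flatness -/

section WeaklyFlat

variable {S : Type u} [Monoid S]

theorem mul_mem_of_mem_rightIdeal {K : SubMulAction Sᵐᵒᵖ S} {a : S} (ha : a ∈ K) (r : S) :
    a * r ∈ K :=
  K.smul_mem (MulOpposite.op r) ha

/-- The inclusion of `aS ∪ a'S` into a right ideal containing `a` and `a'`. -/
def pairIdeal.inclusion {K : SubMulAction Sᵐᵒᵖ S} (a a' : K) :
    pairIdeal (a : S) (a' : S) →[Sᵐᵒᵖ] K where
  toFun x := ⟨x.1, by
    obtain ⟨x, r, rfl | rfl⟩ := x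
    exacts [mul_mem_of_mem_rightIdeal a.2 r, mul_mem_of_mem_rightIdeal a'.2 r]⟩
  map_smul' _ _ := rfl

/-- The ideal `aS ∪ a'S` is the smallest one containing `a` and `a'`; a tossing over it maps into
any other such ideal with the same skeleton, so the same `F` serves. -/
theorem finitelyReplaceable_rightIdealEmbeddings_iff :
    FinitelyReplaceable (rightIdealEmbeddings S) ↔
      ∀ (𝒮 : Skeleton S) (a a' : S),
        ∃ F : Finset (Skeleton S),
          ∀ (B : Type u) [Nonempty B] [MulAction S B],
            CFlat (rightIdealEmbeddings S) B → ∀ b b' : B,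
              Connected 𝒮 a b a' b' →
                ∃ 𝒮' ∈ F, Connected 𝒮' (pairIdeal.left a a') b (pairIdeal.right a a') b' := by
  constructor
  · intro h 𝒮 a a'
    exact h 𝒮 (idealInclusion S (pairIdeal a a') ⟨a, (pairIdeal.left a a').2⟩) ⟨_, _, rfl⟩
      (pairIdeal.left a a') (pairIdeal.right a a')
  · rintro h 𝒮 _ ⟨K, hK, rfl⟩ a a'
    change K at a a'
    obtain ⟨F, hF⟩ := h 𝒮 a a'
    refine ⟨F, fun B _ _ hB b b' hc => ?_⟩
    obtain ⟨𝒯, h𝒯, hc⟩ := hF B hB b b' hc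
    rw [connected_iff] at hc
    exact ⟨𝒯, h𝒯, connected_iff.2 ⟨hc.1.map (pairIdeal.inclusion a a'), hc.2⟩⟩

end WeaklyFlat

end SAct

theorem theorem3p8 (S : Type u) [Monoid S] :
    (∀ C : Set (SAct.RightEmbedding S),
      List.TFAE
        [ SAct.Axiomatisable (SAct.CF C),
          SAct.ClosedUnderUltraproducts (SAct.CF C),
          ∀ (𝒮 : SAct.Skeleton S) (μ : SAct.RightEmbedding S), μ ∈ C → ∀ a a' : μ.dom,
            ∃ F : Finset (SAct.Skeleton S),
              ∀ (B : Type u) [Nonempty B] [MulAction S B], SAct.CFlat C B → ∀ b b' : B,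
                SAct.Connected 𝒮 (μ.hom a) b (μ.hom a') b' →
                  ∃ 𝒮' ∈ F, SAct.Connected 𝒮' a b a' b' ]) ∧
    List.TFAE
      [ SAct.Axiomatisable (SAct.CF (SAct.rightIdealEmbeddings S)),
        SAct.ClosedUnderUltraproducts (SAct.CF (SAct.rightIdealEmbeddings S)),
        ∀ (𝒮 : SAct.Skeleton S) (a a' : S),
          ∃ F : Finset (SAct.Skeleton S),
            ∀ (B : Type u) [Nonempty B] [MulAction S B],
              SAct.CFlat (SAct.rightIdealEmbeddings S) B → ∀ b b' : B,
                SAct.Connected 𝒮 a b a' b' →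
                  ∃ 𝒮' ∈ F, SAct.Connected 𝒮'
                    (SAct.pairIdeal.left a a') b (SAct.pairIdeal.right a a') b' ] := by
  refine ⟨fun C => SAct.tfae_axiomatisable_CF C, ?_⟩
  rw [← SAct.finitelyReplaceable_rightIdealEmbeddings_iff]
  exact SAct.tfae_axiomatisable_CF _
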